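/- For $x\in\mathbb{R}^2$, $r>0$, $0<\alpha<1$ and a one-dimensional linear subspace $\ell$ of $\mathbb{R}^2$ (that is, $\ell\in G(2,1)$), let $B(x,r)$ be the closed Euclidean ball and $$X(x,r,\ell,\alpha)=\{y\in B(x,r) : \operatorname{dist}(y-x,\ell)<\alpha|y-x|\}.$$ By a $C^1$ curve we mean a regular one, i.e. the image of a $C^1$ map $\gamma:\mathbb{R}\to\mathbb{R}^2$ with $\gamma'(t)\neq 0$ for all $t$. Call a set $A\subset\mathbb{R}^2$ $1$-rectifiable if it is covered by countably many $C^1$ curves (no exceptional set is allowed), and call a measure $\mu$ on $\mathbb{R}^2$ purely $1$-unrectifiable if $\mu(A)=0$ for every $1$-rectifiable set $A\subset\mathbb{R}^2$. There exist a line $\ell\in G(2,1)$ and a finite nontrivial Borel measure $\mu$ on $\mathbb{R}^2$ such that $\mu$ is purely $1$-unrectifiable and, for every $0<\alpha<1$, $$\lim_{r\downarrow 0}\frac{\mu\bigl(X(x,r,\ell,\alpha)\bigr)}{\mu\bigl(B(x,r)\bigr)}=0\qquad\text{for }\mu\text{-almost every }x\in\mathbb{R}^2 .$$ -/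

import Mathlib

open Filter Topology MeasureTheory

/-- The Euclidean plane. -/
abbrev Plane : Type := EuclideanSpace ℝ (Fin 2)

/-- `V ∈ G(2,1)`: a one-dimensional linear subspace of the plane. -/
def IsLine (V : Submodule ℝ Plane) : Prop := Module.finrank ℝ V = 1

/-- The cone `X(x,V,α) = {y : dist(y - x, V) < α |y - x|}`. -/
def cone (x : Plane) (V : Submodule ℝ Plane) (α : ℝ) : Set Plane :=
  {y | Metric.infDist (y - x) (V : Set Plane) < α * ‖y - x‖}

/-- The truncated cone `X(x,r,V,α) = B(x,r) ∩ X(x,V,α)`, with `B(x,r)` the closed ball. -/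
def truncCone (x : Plane) (r : ℝ) (V : Submodule ℝ Plane) (α : ℝ) : Set Plane :=
  Metric.closedBall x r ∩ cone x V α

/-- A (regular) parametrised `C¹` curve in the plane. -/
structure IsC1Curve (γ : ℝ → Plane) : Prop where
  contDiff : ContDiff ℝ 1 γ
  deriv_ne_zero : ∀ t, deriv γ t ≠ 0

/-- `1`-rectifiable: covered by countably many `C¹` curves. There is no exceptional set, because
the notion is used for measures that need not be absolutely continuous with respect to
one-dimensional Hausdorff measure. -/
def IsOneRectifiable (A : Set Plane) : Prop :=
  ∃ γ : ℕ → ℝ → Plane, (∀ i, IsC1Curve (γ i)) ∧ A ⊆ ⋃ i, Set.range (γ i)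

/-- Purely `1`-unrectifiable measures: all `1`-rectifiable sets are null. -/
def PurelyOneUnrectifiable (μ : Measure Plane) : Prop :=
  ∀ A : Set Plane, IsOneRectifiable A → μ A = 0

/-!
The measure is the law of a random sum `∑ n, scale n • point`, whose `n`-th digit is chosen
independently from a configuration of points in two opposite columns, at `(k + 2, h)` and
`-(k + 2, h)` with `h ≤ 2 k (k + 2) + 1`; here `k` is the `n`-th term of a sequence `c` that tends
slowly to infinity, and the points at height `h` have mass proportional to `(k + 2) ^ h`.

Seen from a point of height `h`, a double cone of slope at most `k` around the horizontal line
contains no other point of the same column, and only those points of the opposite column whose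
height `h'` satisfies `h + h' ≤ 2 k (k + 2)`. The point at height `h + h' + 1` in the first column
is nearer than the one at height `h'` in the opposite column, and by the exponential growth of
the weights it has at least `k + 1` times the mass of all opposite points up to height `h'`. So at
every level the cone carries at most a proportion `1 / (k + 1)` of the mass of the ball, and the
levels add up to a geometric series.

A regular `C¹` curve is locally contained in a double cone of slope `2` around a coordinate axis
at each of its points. As each configuration has two points on a vertical line and two opposite
ones on the horizontal axis, such a piece of curve misses a digit in every cylinder. It is null
because `c` grows so slowly that the smallest masses of the digits have a divergent sum.
-/

open scoped ENNReal

section Cylinder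

variable {α : ℕ → Type*}

/-- The sequences that leave `x` exactly at position `n`. -/
def shell (x : ∀ n, α n) (n : ℕ) : Set (∀ n, α n) := PiNat.cylinder x n ∩ {y | y n ≠ x n}

lemma exists_mem_shell {x y : ∀ n, α n} (h : y ≠ x) : ∃ n, y ∈ shell x n :=
  ⟨PiNat.firstDiff y x, PiNat.mem_cylinder_firstDiff y x, PiNat.apply_firstDiff_ne h⟩

lemma mem_cylinder_succ_iff {x y : ∀ n, α n} {n : ℕ} :
    y ∈ PiNat.cylinder x (n + 1) ↔ y ∈ PiNat.cylinder x n ∧ y n = x n := by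
  simp only [PiNat.mem_cylinder_iff, Nat.forall_lt_succ_right]

variable [∀ n, MeasurableSpace (α n)] {ν : Measure (∀ n, α n)} {x : ∀ n, α n}

lemma measure_cylinder_add_le {q : ℝ≥0∞}
    (hν : ∀ n, ν (PiNat.cylinder x (n + 1)) ≤ ν (PiNat.cylinder x n) * q) (n j : ℕ) :
    ν (PiNat.cylinder x (n + j)) ≤ ν (PiNat.cylinder x n) * q ^ j := by
  induction j with
  | zero => simp
  | succ j ih =>
    calc ν (PiNat.cylinder x (n + j + 1)) ≤ ν (PiNat.cylinder x (n + j)) * q := hν _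
      _ ≤ ν (PiNat.cylinder x n) * q ^ j * q := by gcongr
      _ = ν (PiNat.cylinder x n) * q ^ (j + 1) := by rw [pow_succ, mul_assoc]

/-- Only the shells from the first one that meets `A` count, and from the next one on the
cylinders are contained in `B`, so that the estimates `hA` sum to a geometric series. -/
lemma measure_le_of_measure_inter_shell_le {A B : Set (∀ n, α n)} {δ : ℝ≥0∞}
    (hν : ∀ n, ν (PiNat.cylinder x (n + 1)) ≤ ν (PiNat.cylinder x n) * 2⁻¹) (hx : x ∉ A)
    (hB : ∀ n, (A ∩ shell x n).Nonempty → PiNat.cylinder x (n + 1) ⊆ B)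
    (hA : ∀ n, ν (A ∩ shell x n) ≤ δ * ν (B ∩ PiNat.cylinder x n)) :
    ν A ≤ 4 * δ * ν B := by
  classical
  have exists_shell : ∀ y ∈ A, ∃ n, y ∈ A ∩ shell x n := fun y hy =>
    (exists_mem_shell (ne_of_mem_of_not_mem hy hx)).imp fun _ h => ⟨hy, h⟩
  rcases A.eq_empty_or_nonempty with rfl | ⟨y, hy⟩
  · simp
  have hex : ∃ n, (A ∩ shell x n).Nonempty := (exists_shell y hy).imp fun _ h => ⟨y, h⟩
  set M := Nat.find hex
  have hcyl : ∀ j, ν (B ∩ PiNat.cylinder x (M + j)) ≤ ν B * (2 * 2⁻¹ ^ j) := by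
    rintro (_ | j)
    · calc ν (B ∩ PiNat.cylinder x M) ≤ ν B * 1 := by
            rw [mul_one]; exact measure_mono Set.inter_subset_left
        _ ≤ ν B * (2 * 2⁻¹ ^ 0) := by gcongr; norm_num
    · calc ν (B ∩ PiNat.cylinder x (M + (j + 1))) ≤ ν (PiNat.cylinder x (M + 1 + j)) := by
            rw [add_right_comm, ← add_assoc]; exact measure_mono Set.inter_subset_right
        _ ≤ ν (PiNat.cylinder x (M + 1)) * 2⁻¹ ^ j := measure_cylinder_add_le hν _ _
        _ ≤ ν B * 2⁻¹ ^ j := by gcongr; exact hB M (Nat.find_spec hex)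
        _ = ν B * (2 * 2⁻¹ ^ (j + 1)) := by
            rw [pow_succ', ← mul_assoc 2, ENNReal.mul_inv_cancel two_ne_zero ENNReal.ofNat_ne_top,
              one_mul]
  have hcover : A ⊆ ⋃ j, A ∩ shell x (M + j) := fun z hz => by
    obtain ⟨n, hn⟩ := exists_shell z hz
    obtain ⟨j, rfl⟩ := Nat.exists_eq_add_of_le (Nat.find_min' hex ⟨z, hn⟩)
    exact Set.mem_iUnion.2 ⟨j, hn⟩
  calc ν A ≤ ∑' j, ν (A ∩ shell x (M + j)) := (measure_mono hcover).trans (measure_iUnion_le _)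
    _ ≤ ∑' j, δ * (ν B * (2 * 2⁻¹ ^ j)) :=
        ENNReal.tsum_le_tsum fun j => (hA _).trans (by gcongr; exact hcyl j)
    _ = 4 * δ * ν B := by
        simp only [ENNReal.tsum_mul_left, ENNReal.tsum_geometric, ENNReal.one_sub_inv_two, inv_inv]
        ring

end Cylinder

section ProductMeasure

variable {α : ℕ → Type*} [∀ n, MeasurableSpace (α n)] [∀ n, MeasurableSingletonClass (α n)]
  {μ : ∀ n, Measure (α n)} [∀ n, IsProbabilityMeasure (μ n)]

lemma infinitePi_cylinder_inter (x : ∀ n, α n) (n : ℕ) {S : Set (α n)} (hS : MeasurableSet S) :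
    Measure.infinitePi μ (PiNat.cylinder x n ∩ {y | y n ∈ S}) =
      Measure.infinitePi μ (PiNat.cylinder x n) * μ n S := by
  classical
  set T : ∀ k, Set (α k) := Function.update (fun k => {x k}) n S
  have hT : ∀ k < n, T k = {x k} := fun k hk => Function.update_of_ne hk.ne _ _
  have hTn : T n = S := Function.update_self ..
  have hset : PiNat.cylinder x n ∩ {y | y n ∈ S} = Set.pi (Finset.range (n + 1)) T := by
    ext y
    simp only [Set.mem_inter_iff, PiNat.mem_cylinder_iff, Set.mem_ofPred_eq, Set.mem_pi,
      Finset.mem_coe, Finset.mem_range, Nat.forall_lt_succ_right, hTn]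
    exact and_congr_left' (forall₂_congr fun k hk => by rw [hT k hk, Set.mem_singleton_iff])
  have hmeas : ∀ k ∈ Finset.range (n + 1), MeasurableSet (T k) := fun k hk => by
    rcases Nat.lt_succ_iff_lt_or_eq.1 (Finset.mem_range.1 hk) with hk | rfl
    · rw [hT k hk]; exact measurableSet_singleton _
    · rwa [hTn]
  rw [hset, PiNat.cylinder_eq_pi, Measure.infinitePi_pi _ hmeas,
    Measure.infinitePi_pi _ fun _ _ => measurableSet_singleton _, Finset.prod_range_succ, hTn]
  congr 1
  exact Finset.prod_congr rfl fun k hk => by rw [hT k (Finset.mem_range.1 hk)]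

lemma infinitePi_cylinder_succ (x : ∀ n, α n) (n : ℕ) :
    Measure.infinitePi μ (PiNat.cylinder x (n + 1)) =
      Measure.infinitePi μ (PiNat.cylinder x n) * μ n {x n} := by
  rw [← infinitePi_cylinder_inter x n (measurableSet_singleton _)]
  congr 1
  ext y
  exact mem_cylinder_succ_iff

lemma infinitePi_cylinder_update_succ (x : ∀ n, α n) (n : ℕ) (a : α n) :
    Measure.infinitePi μ (PiNat.cylinder (Function.update x n a) (n + 1)) =
      Measure.infinitePi μ (PiNat.cylinder x n) * μ n {a} := by
  rw [infinitePi_cylinder_succ, Function.update_self,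
    PiNat.mem_cylinder_iff_eq.1 (PiNat.update_mem_cylinder x n a)]

variable [∀ n, Finite (α n)] {p : ℕ → ℝ} {E : Set (∀ n, α n)}

lemma infinitePi_real_inter_cylinder_le (hp : ∀ n a, p n ≤ (μ n).real {a})
    (hE : ∀ (x : ∀ n, α n) n, ∃ a, ∀ y ∈ E ∩ PiNat.cylinder x n, y n ≠ a) (j m : ℕ)
    (x : ∀ n, α n) :
    (Measure.infinitePi μ).real (E ∩ PiNat.cylinder x m) ≤
      (Measure.infinitePi μ).real (PiNat.cylinder x m) *
        Real.exp (-∑ k ∈ Finset.range j, p (m + k)) := by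
  classical
  have := fun n => Fintype.ofFinite (α n)
  induction j generalizing m x with
  | zero => simpa using measureReal_mono Set.inter_subset_right
  | succ j ih =>
    obtain ⟨a, ha⟩ := hE x m
    have hcover : E ∩ PiNat.cylinder x m ⊆
        ⋃ d ∈ Finset.univ.erase a, E ∩ PiNat.cylinder (Function.update x m d) (m + 1) := by
      intro y hy
      simp only [Set.mem_iUnion]
      refine ⟨y m, Finset.mem_erase.2 ⟨ha y hy, Finset.mem_univ _⟩, hy.1,
        mem_cylinder_succ_iff.2 ⟨?_, by simp⟩⟩
      rw [PiNat.mem_cylinder_iff_eq.1 (PiNat.update_mem_cylinder x m _)]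
      exact hy.2
    have hrest : ∑ d ∈ Finset.univ.erase a, (μ m).real {d} ≤ Real.exp (-p m) := by
      have htotal : ∑ d, (μ m).real {d} = 1 := by simp
      rw [← Finset.add_sum_erase _ _ (Finset.mem_univ a)] at htotal
      linarith [hp m a, Real.add_one_le_exp (-p m)]
    set tail : ℝ := Real.exp (-∑ k ∈ Finset.range j, p (m + 1 + k))
    calc (Measure.infinitePi μ).real (E ∩ PiNat.cylinder x m)
        ≤ ∑ d ∈ Finset.univ.erase a,
            (Measure.infinitePi μ).real (E ∩ PiNat.cylinder (Function.update x m d) (m + 1)) :=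
          (measureReal_mono hcover (measure_ne_top _ _)).trans (measureReal_biUnion_finset_le _ _)
      _ ≤ ∑ d ∈ Finset.univ.erase a,
            (Measure.infinitePi μ).real (PiNat.cylinder x m) * (μ m).real {d} * tail := by
          refine Finset.sum_le_sum fun d _ => (ih (m + 1) _).trans_eq ?_
          simp only [measureReal_def, infinitePi_cylinder_update_succ, ENNReal.toReal_mul, tail]
      _ = (Measure.infinitePi μ).real (PiNat.cylinder x m) *
            ((∑ d ∈ Finset.univ.erase a, (μ m).real {d}) * tail) := by
          rw [← Finset.sum_mul, ← Finset.mul_sum, mul_assoc]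
      _ ≤ (Measure.infinitePi μ).real (PiNat.cylinder x m) * (Real.exp (-p m) * tail) := by gcongr
      _ = (Measure.infinitePi μ).real (PiNat.cylinder x m) *
            Real.exp (-∑ k ∈ Finset.range (j + 1), p (m + k)) := by
          rw [← Real.exp_add, Finset.sum_range_succ', add_zero, neg_add_rev]
          simp only [add_right_comm, add_assoc]

lemma infinitePi_eq_zero_of_forall_exists_missing (hp₀ : ∀ n, 0 ≤ p n) (hdiv : ¬Summable p)
    (hp : ∀ n a, p n ≤ (μ n).real {a})
    (hE : ∀ (x : ∀ n, α n) n, ∃ a, ∀ y ∈ E ∩ PiNat.cylinder x n, y n ≠ a) :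
    Measure.infinitePi μ E = 0 := by
  obtain rfl | ⟨x, -⟩ := E.eq_empty_or_nonempty
  · exact measure_empty
  have hle : ∀ j, (Measure.infinitePi μ).real E ≤ Real.exp (-∑ k ∈ Finset.range j, p k) :=
    fun j => by simpa using infinitePi_real_inter_cylinder_le hp hE j 0 x
  have hlim : Tendsto (fun j => Real.exp (-∑ k ∈ Finset.range j, p k)) atTop (𝓝 0) :=
    Real.tendsto_exp_neg_atTop_nhds_zero.comp
      ((not_summable_iff_tendsto_nat_atTop_of_nonneg hp₀).1 hdiv)
  exact (measureReal_eq_zero_iff (measure_ne_top _ _)).1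
    (le_antisymm (ge_of_tendsto' hlim hle) measureReal_nonneg)

end ProductMeasure

section DigitSeries

variable {α : ℕ → Type*} {E : Type*} [NormedAddCommGroup E] {v : ∀ n, α n → E} {b : ℕ → ℝ}

/-- The point whose expansion has the digits `x n`, the digit `a` in position `n` contributing
the vector `v n a`. -/
noncomputable def digitSeries (v : ∀ n, α n → E) (x : ∀ n, α n) : E := ∑' n, v n (x n)

lemma continuous_digitSeries [∀ n, TopologicalSpace (α n)] [CompleteSpace E]
    (hv : ∀ n, Continuous (v n)) (hb : Summable b) (hvb : ∀ n a, ‖v n a‖ ≤ b n) :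
    Continuous (digitSeries v) :=
  continuous_tsum (fun n => (hv n).comp (continuous_apply n)) hb fun n x => hvb n (x n)

lemma norm_digitSeries_sub_sub_le [CompleteSpace E] (hb : Summable b) (hvb : ∀ n a, ‖v n a‖ ≤ b n)
    {x y : ∀ n, α n} {n : ℕ} (h : y ∈ PiNat.cylinder x n) :
    ‖digitSeries v y - digitSeries v x - (v n (y n) - v n (x n))‖ ≤
      2 * ∑' j, b (j + (n + 1)) := by
  have hsum : ∀ z : ∀ n, α n, Summable fun k => v k (z k) := fun z =>
    .of_norm_bounded hb fun k => hvb k (z k)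
  have htail := ((hsum y).sub (hsum x)).sum_add_tsum_nat_add (n + 1)
  rw [(hsum y).tsum_sub (hsum x), Finset.sum_range_succ, Finset.sum_eq_zero fun k hk => by
    rw [h k (Finset.mem_range.1 hk), sub_self], zero_add] at htail
  rw [digitSeries, digitSeries, ← htail, add_sub_cancel_left, ← tsum_mul_left]
  refine tsum_of_norm_bounded (((summable_nat_add_iff (n + 1)).2 hb).mul_left 2).hasSum fun j => ?_
  calc ‖v (j + (n + 1)) (y (j + (n + 1))) - v (j + (n + 1)) (x (j + (n + 1)))‖
      ≤ b (j + (n + 1)) + b (j + (n + 1)) := norm_sub_le_of_le (hvb _ _) (hvb _ _)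
    _ = 2 * b (j + (n + 1)) := (two_mul _).symm

lemma le_mul_geometric_of_succ_le_half (h : ∀ n, b (n + 1) ≤ b n * (1 / 2)) (j n : ℕ) :
    b (j + n) ≤ b n * (1 / 2) ^ j := by
  induction j with
  | zero => simp
  | succ j ih =>
    rw [Nat.add_right_comm, pow_succ, ← mul_assoc]
    linarith [h (j + n)]

lemma summable_of_succ_le_half (hb : ∀ n, 0 ≤ b n) (h : ∀ n, b (n + 1) ≤ b n * (1 / 2)) :
    Summable b :=
  .of_nonneg_of_le hb (fun n => le_mul_geometric_of_succ_le_half h n 0)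
    (summable_geometric_two.mul_left _)

lemma tsum_nat_add_le_of_succ_le_half (hb : ∀ n, 0 ≤ b n) (h : ∀ n, b (n + 1) ≤ b n * (1 / 2))
    (n : ℕ) : ∑' j, b (j + n) ≤ 2 * b n := by
  calc ∑' j, b (j + n) ≤ ∑' j, b n * (1 / 2) ^ j :=
        ((summable_nat_add_iff n).2 (summable_of_succ_le_half hb h)).tsum_le_tsum
          (fun j => le_mul_geometric_of_succ_le_half h j n) (summable_geometric_two.mul_left _)
    _ = 2 * b n := by rw [tsum_mul_left, tsum_geometric_two, mul_comm]

end DigitSeries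

section Plane

lemma sq_norm_plane (v : Plane) : ‖v‖ ^ 2 = v 0 ^ 2 + v 1 ^ 2 := by
  rw [EuclideanSpace.real_norm_sq_eq, Fin.sum_univ_two]

lemma norm_plane_le_abs_add_abs (v : Plane) : ‖v‖ ≤ |v 0| + |v 1| := by
  refine le_of_sq_le_sq ?_ (by positivity)
  rw [sq_norm_plane, add_sq, sq_abs, sq_abs]
  linarith [mul_nonneg (abs_nonneg (v 0)) (abs_nonneg (v 1))]

/-- The double cone with vertex `x` and slope `C` around the horizontal line, without its
vertex. -/
def flatCone (C : ℝ) (x : Plane) : Set Plane := {y | y ≠ x ∧ |y 1 - x 1| ≤ C * |y 0 - x 0|}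

/-- The horizontal axis. -/
noncomputable def horizontalAxis : Submodule ℝ Plane :=
  Submodule.span ℝ {EuclideanSpace.single 0 1}

lemma isLine_horizontalAxis : IsLine horizontalAxis := finrank_span_singleton (by simp)

lemma abs_one_le_infDist_horizontalAxis (v : Plane) :
    |v 1| ≤ Metric.infDist v (horizontalAxis : Set Plane) := by
  refine (Metric.le_infDist ⟨0, horizontalAxis.zero_mem⟩).2 fun w hw => ?_
  obtain ⟨a, rfl⟩ := Submodule.mem_span_singleton.1 hw
  simpa [dist_eq_norm] using
    PiLp.norm_apply_le (v - a • (EuclideanSpace.single 0 1 : Plane)) 1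

lemma cone_horizontalAxis_subset_flatCone (x : Plane) {α C : ℝ} (hα : α < 1)
    (hC : 1 / (1 - α) ≤ C) : cone x horizontalAxis α ⊆ flatCone C x := by
  intro y hy
  have hlt : |y 1 - x 1| < α * ‖y - x‖ :=
    (abs_one_le_infDist_horizontalAxis (y - x)).trans_lt hy
  refine ⟨fun h => ?_, ?_⟩
  · simp [h] at hlt
  have hα₀ : 0 < α := pos_of_mul_pos_left ((abs_nonneg _).trans_lt hlt) (norm_nonneg _)
  have hnorm : ‖y - x‖ ≤ |y 0 - x 0| + |y 1 - x 1| := norm_plane_le_abs_add_abs (y - x)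
  have hslope : (1 - α) * |y 1 - x 1| ≤ |y 0 - x 0| := by
    nlinarith [abs_nonneg (y 0 - x 0)]
  calc |y 1 - x 1| ≤ 1 / (1 - α) * |y 0 - x 0| := by
        rwa [one_div_mul_eq_div, le_div_iff₀' (sub_pos.2 hα)]
    _ ≤ C * |y 0 - x 0| := by gcongr

lemma measurableSet_truncCone (x : Plane) (r : ℝ) (V : Submodule ℝ Plane) (α : ℝ) :
    MeasurableSet (truncCone x r V α) := by
  refine Metric.isClosed_closedBall.measurableSet.inter (isOpen_lt ?_ ?_).measurableSet
  · exact (Metric.continuous_infDist_pt _).comp (continuous_sub_right x)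
  · fun_prop

end Plane

lemma abs_signed_sub_signed {a b : ℝ} (ha : 0 ≤ a) (hb : 0 ≤ b) (s t : Bool) :
    |(if t then b else -b) - (if s then a else -a)| = if t = s then |b - a| else b + a := by
  have h : |-b - a| = b + a := by
    rw [← abs_neg, neg_sub', neg_neg, sub_neg_eq_add, abs_of_nonneg (by positivity)]
  cases s <;> cases t <;>
    simp [abs_sub_comm, h, abs_of_nonneg (add_nonneg hb ha), ← sub_eq_neg_add]

/-- The points of the `k`-th configuration, which lie in two columns: `(i, true)` encodes the
point at height `i` in the right column and `(i, false)` the opposite point, in the left one. -/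
abbrev Digit (k : ℕ) : Type := Fin (2 * k * (k + 2) + 2) × Bool

namespace Digit

variable {k : ℕ} {d d' m : Digit k}

/-- The distance to the horizontal axis of the point encoded by a digit. -/
def height (d : Digit k) : ℕ := d.1

/-- The point encoded by a digit. -/
noncomputable def point (d : Digit k) : Plane :=
  (if d.2 then 1 else -1 : ℝ) • !₂[(k + 2 : ℝ), (d.height : ℝ)]

lemma point_zero (d : Digit k) : d.point 0 = if d.2 then (k + 2 : ℝ) else -(k + 2) := by
  by_cases h : d.2 <;> simp [point, h, add_comm]

lemma point_one (d : Digit k) : d.point 1 = if d.2 then (d.height : ℝ) else -d.height := by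
  by_cases h : d.2 <;> simp [point, h]

lemma abs_point_sub_point_zero (d d' : Digit k) :
    |d'.point 0 - d.point 0| = if d'.2 = d.2 then 0 else 2 * (k + 2 : ℝ) := by
  rw [point_zero, point_zero, abs_signed_sub_signed (by positivity) (by positivity), sub_self,
    abs_zero, two_mul (k + 2 : ℝ)]

lemma abs_point_sub_point_one (d d' : Digit k) :
    |d'.point 1 - d.point 1| =
      if d'.2 = d.2 then |(d'.height : ℝ) - d.height| else (d'.height : ℝ) + d.height := by
  rw [point_one, point_one, abs_signed_sub_signed d.height.cast_nonneg d'.height.cast_nonneg]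

/-- A bound for the distance of the points of a configuration to the origin. -/
def radius (k : ℕ) : ℝ := 2 * (k + 2) ^ 2

lemma radius_pos (k : ℕ) : 0 < radius k := by unfold radius; positivity

lemma one_le_radius (k : ℕ) : 1 ≤ radius k := by
  unfold radius; nlinarith [k.cast_nonneg (α := ℝ)]

lemma norm_point_le (d : Digit k) : ‖d.point‖ ≤ radius k := by
  have hh : (d.height : ℝ) ≤ 2 * k * (k + 2) + 1 := by
    exact_mod_cast Nat.lt_succ_iff.1 d.1.isLt
  calc ‖d.point‖ ≤ |d.point 0| + |d.point 1| := norm_plane_le_abs_add_abs _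
    _ = (k + 2) + d.height := by
        have hk : |(k + 2 : ℝ)| = k + 2 := abs_of_pos (by positivity)
        rw [point_zero, point_one, apply_ite abs, apply_ite abs, abs_neg, abs_neg, ite_self,
          ite_self, hk, Nat.abs_cast]
    _ ≤ radius k := by unfold radius; nlinarith [k.cast_nonneg (α := ℝ)]

lemma one_le_abs_height_sub (hcol : d'.2 = d.2) (h : d' ≠ d) :
    1 ≤ |(d'.height : ℝ) - d.height| := by
  have hne : (d'.height : ℤ) - d.height ≠ 0 := fun e =>
    h (Prod.ext (Fin.ext (Nat.cast_injective (R := ℤ) (sub_eq_zero.1 e))) hcol)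
  exact_mod_cast Int.one_le_abs hne

lemma one_le_norm_point_sub_point (h : d' ≠ d) : 1 ≤ ‖d'.point - d.point‖ := by
  by_cases hcol : d'.2 = d.2
  · refine le_trans ?_ (PiLp.norm_apply_le (d'.point - d.point) 1)
    rw [Real.norm_eq_abs, PiLp.sub_apply, abs_point_sub_point_one, if_pos hcol]
    exact one_le_abs_height_sub hcol h
  · refine le_trans ?_ (PiLp.norm_apply_le (d'.point - d.point) 0)
    rw [Real.norm_eq_abs, PiLp.sub_apply, abs_point_sub_point_zero, if_neg hcol]
    linarith [k.cast_nonneg (α := ℝ)]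

/-- `d'` is in the column opposite to `d` and, up to the tolerance, in the double cone of slope
`k` around the horizontal line through `d`. -/
def Faces (d d' : Digit k) : Prop := d'.2 ≠ d.2 ∧ d.height + d'.height ≤ 2 * k * (k + 2)

/-- The size of the perturbations of differences of points of the `k`-th configuration that the
estimates allow. -/
noncomputable def tolerance (k : ℕ) : ℝ := 1 / (4 * (k + 1))

lemma tolerance_pos (k : ℕ) : 0 < tolerance k := by unfold tolerance; positivity

lemma add_one_mul_tolerance (k : ℕ) : (k + 1) * tolerance k = 1 / 4 := by
  unfold tolerance; field_simp

lemma tolerance_le (k : ℕ) : tolerance k ≤ 1 / 4 := by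
  rw [← add_one_mul_tolerance k]
  exact le_mul_of_one_le_left (tolerance_pos k).le (by simp)

lemma faces_of_abs_le (hne : d' ≠ d) {p : Plane}
    (hp : ‖p - (d'.point - d.point)‖ ≤ tolerance k) (hflat : |p 1| ≤ k * |p 0|) :
    d.Faces d' := by
  have hcoord : ∀ i, |(|p i| - |d'.point i - d.point i|)| ≤ tolerance k := fun i =>
    (abs_abs_sub_abs_le _ _).trans ((PiLp.norm_apply_le (p - (d'.point - d.point)) i).trans hp)
  have h0 := (abs_le.1 (hcoord 0)).2
  have h1 := (abs_le.1 (hcoord 1)).1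
  rw [abs_point_sub_point_zero] at h0
  rw [abs_point_sub_point_one] at h1
  have hk := add_one_mul_tolerance k
  by_cases hcol : d'.2 = d.2
  · rw [if_pos hcol] at h0 h1
    have := mul_le_mul_of_nonneg_left h0 k.cast_nonneg
    linarith [one_le_abs_height_sub hcol hne]
  · rw [if_neg hcol] at h0 h1
    have := mul_le_mul_of_nonneg_left h0 k.cast_nonneg
    have hheight : (d.height + d'.height : ℝ) < 2 * k * (k + 2) + 1 := by linarith
    exact ⟨hcol, Nat.lt_succ_iff.1 (by exact_mod_cast hheight)⟩

lemma norm_point_sub_add_le_of_faces (hface : d.Faces d') (hcol : m.2 = d.2)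
    (hm : |(m.height : ℝ) - d.height| ≤ d.height + d'.height + 1) :
    ‖m.point - d.point‖ + 2 * tolerance k ≤ ‖d'.point - d.point‖ := by
  obtain ⟨hcol', hs⟩ := hface
  have hs : (d.height + d'.height : ℝ) ≤ 2 * k * (k + 2) := by exact_mod_cast hs
  set s : ℝ := d.height + d'.height
  have hnear : ‖m.point - d.point‖ ≤ s + 1 := by
    refine (norm_plane_le_abs_add_abs _).trans ?_
    rwa [PiLp.sub_apply, PiLp.sub_apply, abs_point_sub_point_zero, abs_point_sub_point_one,
      if_pos hcol, if_pos hcol, zero_add]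
  have hfar : ‖d'.point - d.point‖ ^ 2 = (2 * (k + 2)) ^ 2 + s ^ 2 := by
    rw [sq_norm_plane, ← sq_abs, ← sq_abs ((d'.point - d.point) 1), PiLp.sub_apply, PiLp.sub_apply,
      abs_point_sub_point_zero, abs_point_sub_point_one, if_neg hcol', if_neg hcol',
      add_comm (d'.height : ℝ)]
  have hsum : s + 1 + 2 * tolerance k ≤ ‖d'.point - d.point‖ := by
    refine le_of_sq_le_sq ?_ (norm_nonneg _)
    have hη := tolerance_pos k
    have hη' := tolerance_le k
    have hsη : 4 * (s * tolerance k) ≤ 2 * (k + 2) := by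
      nlinarith [add_one_mul_tolerance k]
    rw [hfar]
    nlinarith [k.cast_nonneg (α := ℝ)]
  linarith

/-- The unnormalised mass of the point encoded by a digit. -/
noncomputable def weight (d : Digit k) : ℝ≥0∞ := ((k + 2) ^ d.height : ℕ)

lemma one_le_weight (d : Digit k) : 1 ≤ d.weight := by
  rw [weight]
  exact_mod_cast Nat.one_le_pow d.height (k + 2) (Nat.succ_pos _)

lemma sum_weight_ne_zero (k : ℕ) : ∑ d : Digit k, d.weight ≠ 0 := fun h => by
  have h₀ := Finset.sum_eq_zero_iff.1 h (0, true) (Finset.mem_univ _)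
  exact (zero_lt_one.trans_le (one_le_weight (0, true))).ne' h₀

lemma sum_weight_ne_top (k : ℕ) : ∑ d : Digit k, d.weight ≠ ∞ :=
  ENNReal.sum_ne_top.2 fun _ _ => ENNReal.natCast_ne_top _

lemma sum_column_weight_mul_le {m : Digit k} (b : Bool) {i : ℕ} (h : i < m.height) :
    (∑ d : Digit k with d.2 = b ∧ d.height ≤ i, d.weight) * (k + 1) ≤ m.weight := by
  set S : Finset (Digit k) := {d | d.2 = b ∧ d.height ≤ i} with hS
  have hinj : Set.InjOn height (S : Set (Digit k)) := fun d hd d' hd' e => by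
    simp only [hS, Finset.coe_filter_univ, Set.mem_ofPred_eq] at hd hd'
    exact Prod.ext (Fin.ext e) (hd.1.trans hd'.1.symm)
  have hsum : (∑ d ∈ S, (k + 2) ^ d.height) * (k + 1) ≤ (k + 2) ^ m.height := by
    calc (∑ d ∈ S, (k + 2) ^ d.height) * (k + 1)
        = (∑ j ∈ S.image height, (k + 2) ^ j) * (k + 1) := by rw [Finset.sum_image hinj]
      _ ≤ (∑ j ∈ Finset.range (i + 1), (k + 1 + 1) ^ j) * (k + 1) := by
          gcongr
          simp only [hS, Finset.image_subset_iff, Finset.mem_filter_univ, Finset.mem_range]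
          exact fun d hd => Nat.lt_succ_of_le hd.2
      _ ≤ (k + 2) ^ (i + 1) := (Nat.le_succ _).trans_eq (geom_sum_mul_add (k + 1) (i + 1))
      _ ≤ (k + 2) ^ m.height := Nat.pow_le_pow_right (Nat.succ_pos _) h
  simp only [weight]
  exact_mod_cast hsum

end Digit

section DigitMeasure

variable {k : ℕ}

/-- The probability measure on the digits that is proportional to their weights. -/
noncomputable def digitMeasure (k : ℕ) : Measure (Digit k) :=
  (∑ d : Digit k, d.weight)⁻¹ • Measure.sum fun d : Digit k => d.weight • Measure.dirac d

lemma digitMeasure_finset (S : Finset (Digit k)) :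
    digitMeasure k S = (∑ d : Digit k, d.weight)⁻¹ * ∑ d ∈ S, d.weight := by
  classical
  simp [digitMeasure, Set.indicator_apply]

instance (k : ℕ) : IsProbabilityMeasure (digitMeasure k) where
  measure_univ := by
    rw [← Finset.coe_univ, digitMeasure_finset,
      ENNReal.inv_mul_cancel (Digit.sum_weight_ne_zero k) (Digit.sum_weight_ne_top k)]

lemma digitMeasure_singleton (d : Digit k) :
    digitMeasure k {d} = (∑ d : Digit k, d.weight)⁻¹ * d.weight := by
  simpa using digitMeasure_finset {d}

/-- The smallest mass of a digit. -/
noncomputable def minMass (k : ℕ) : ℝ := ((∑ d : Digit k, d.weight)⁻¹).toReal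

lemma minMass_pos (k : ℕ) : 0 < minMass k :=
  ENNReal.toReal_pos (ENNReal.inv_ne_zero.2 (Digit.sum_weight_ne_top k))
    (ENNReal.inv_ne_top.2 (Digit.sum_weight_ne_zero k))

lemma minMass_le (d : Digit k) : minMass k ≤ (digitMeasure k).real {d} := by
  refine ENNReal.toReal_mono (measure_ne_top _ _) ?_
  rw [digitMeasure_singleton]
  exact le_mul_of_one_le_right' d.one_le_weight

lemma digitMeasure_singleton_le (d : Digit k) : digitMeasure k {d} ≤ 2⁻¹ := by
  have hne : d ≠ (d.1, !d.2) := fun h => by simpa using congrArg Prod.snd h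
  have hmirror : digitMeasure k {(d.1, !d.2)} = digitMeasure k {d} := by
    rw [digitMeasure_singleton, digitMeasure_singleton]
    rfl
  rw [ENNReal.le_inv_iff_mul_le, mul_two]
  calc digitMeasure k {d} + digitMeasure k {d}
      = digitMeasure k ({d} ∪ {(d.1, !d.2)}) := by
        rw [measure_union (by simpa using hne) (measurableSet_singleton _), hmirror]
    _ ≤ 1 := prob_le_one

lemma digitMeasure_column_le {m : Digit k} (b : Bool) {i : ℕ} (h : i < m.height) :
    digitMeasure k {d | d.2 = b ∧ d.height ≤ i} ≤ (k + 1 : ℝ≥0∞)⁻¹ * digitMeasure k {m} := by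
  have hset : {d : Digit k | d.2 = b ∧ d.height ≤ i} =
      (({d | d.2 = b ∧ d.height ≤ i} : Finset (Digit k)) : Set (Digit k)) := by simp
  rw [hset, digitMeasure_finset, digitMeasure_singleton, mul_left_comm, mul_comm _⁻¹ m.weight]
  gcongr
  exact ENNReal.le_div_iff_mul_le (by simp) (by simp) |>.2 (Digit.sum_column_weight_mul_le b h)

end DigitMeasure

/-- Sequences of digits, the `n`-th digit being a point of the configuration `c n`. -/
abbrev Code (c : ℕ → ℕ) : Type := ∀ n, Digit (c n)

section Code

variable {c : ℕ → ℕ} {x y z : Code c} {n : ℕ}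

/-- The ratio of the copies of the `n`-th configuration. It is so small compared to the previous
one that all later digits move a point by at most `scale c n * Digit.tolerance (c n)`. -/
noncomputable def scale (c : ℕ → ℕ) : ℕ → ℝ
  | 0 => 1
  | n + 1 => scale c n * Digit.tolerance (c n) / (4 * Digit.radius (c (n + 1)))

lemma scale_pos (c : ℕ → ℕ) : ∀ n, 0 < scale c n
  | 0 => one_pos
  | n + 1 => by
    have := scale_pos c n
    have := Digit.tolerance_pos (c n)
    have := Digit.radius_pos (c (n + 1))
    rw [scale]
    positivity

lemma scale_succ_mul_radius (c : ℕ → ℕ) (n : ℕ) :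
    scale c (n + 1) * Digit.radius (c (n + 1)) = scale c n * Digit.tolerance (c n) / 4 := by
  have := (Digit.radius_pos (c (n + 1))).ne'
  rw [scale]
  field_simp

lemma scale_mul_radius_nonneg (c : ℕ → ℕ) (n : ℕ) : 0 ≤ scale c n * Digit.radius (c n) :=
  (mul_pos (scale_pos c n) (Digit.radius_pos (c n))).le

lemma scale_mul_radius_succ_le_half (c : ℕ → ℕ) (n : ℕ) :
    scale c (n + 1) * Digit.radius (c (n + 1)) ≤ scale c n * Digit.radius (c n) * (1 / 2) := by
  have := mul_le_mul_of_nonneg_left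
    ((Digit.tolerance_le (c n)).trans (by linarith [Digit.one_le_radius (c n)] :
      1 / 4 ≤ Digit.radius (c n))) (scale_pos c n).le
  have := scale_mul_radius_nonneg c n
  rw [scale_succ_mul_radius]
  linarith

lemma scale_antitone (c : ℕ → ℕ) : Antitone (scale c) := antitone_nat_of_succ_le fun n => by
  have h := scale_succ_mul_radius c n
  have := mul_le_mul_of_nonneg_left (Digit.tolerance_le (c n)) (scale_pos c n).le
  have := mul_le_mul_of_nonneg_left (Digit.one_le_radius (c (n + 1))) (scale_pos c (n + 1)).le
  linarith [scale_pos c n]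

/-- The point of the plane with a given sequence of digits. -/
noncomputable def codePoint (c : ℕ → ℕ) : Code c → Plane :=
  digitSeries fun n d => scale c n • d.point

lemma norm_scale_smul_point_le (c : ℕ → ℕ) (n : ℕ) (d : Digit (c n)) :
    ‖scale c n • d.point‖ ≤ scale c n * Digit.radius (c n) := by
  rw [norm_smul, Real.norm_of_nonneg (scale_pos c n).le]
  exact mul_le_mul_of_nonneg_left d.norm_point_le (scale_pos c n).le

lemma summable_scale_mul_radius (c : ℕ → ℕ) :
    Summable fun n => scale c n * Digit.radius (c n) :=
  summable_of_succ_le_half (scale_mul_radius_nonneg c) (scale_mul_radius_succ_le_half c)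

lemma continuous_codePoint (c : ℕ → ℕ) : Continuous (codePoint c) :=
  continuous_digitSeries (fun _ => continuous_of_discreteTopology) (summable_scale_mul_radius c)
    (norm_scale_smul_point_le c)

lemma norm_inv_scale_smul_codePoint_sub_sub_le (h : y ∈ PiNat.cylinder x n) :
    ‖(scale c n)⁻¹ • (codePoint c y - codePoint c x) - ((y n).point - (x n).point)‖ ≤
      Digit.tolerance (c n) := by
  have hs := scale_pos c n
  have hle := norm_digitSeries_sub_sub_le (summable_scale_mul_radius c)
    (norm_scale_smul_point_le c) h
  have htail := tsum_nat_add_le_of_succ_le_half (scale_mul_radius_nonneg c)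
    (scale_mul_radius_succ_le_half c) (n + 1)
  rw [scale_succ_mul_radius] at htail
  rw [← smul_sub] at hle
  rw [← inv_smul_smul₀ hs.ne' ((y n).point - (x n).point), ← smul_sub, norm_smul, norm_inv,
    Real.norm_of_nonneg hs.le, inv_mul_le_iff₀ hs]
  exact hle.trans (by linarith)

lemma abs_dist_codePoint_div_scale_sub_le (h : y ∈ PiNat.cylinder x n) :
    |dist (codePoint c y) (codePoint c x) / scale c n - ‖(y n).point - (x n).point‖| ≤
      Digit.tolerance (c n) := by
  refine le_trans ?_ (norm_inv_scale_smul_codePoint_sub_sub_le h)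
  refine le_of_eq_of_le ?_ (abs_norm_sub_norm_le _ _)
  rw [norm_smul, norm_inv, Real.norm_of_nonneg (scale_pos c n).le, dist_eq_norm, div_eq_inv_mul]

lemma scale_div_two_le_dist_codePoint (h : y ∈ shell x n) :
    scale c n / 2 ≤ dist (codePoint c y) (codePoint c x) := by
  have hsep := (x n).one_le_norm_point_sub_point h.2
  have hdist := (abs_le.1 (abs_dist_codePoint_div_scale_sub_le h.1)).1
  have := (le_div_iff₀ (scale_pos c n)).1
    (by linarith [Digit.tolerance_le (c n)] : 1 / 2 ≤ dist (codePoint c y) (codePoint c x) / _)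
  linarith

lemma dist_codePoint_le_of_faces (hy : y ∈ PiNat.cylinder x n) (hface : (x n).Faces (y n))
    (hz : z ∈ PiNat.cylinder x n) (hcol : (z n).2 = (x n).2)
    (hheight : |((z n).height : ℝ) - (x n).height| ≤ (x n).height + (y n).height + 1) :
    dist (codePoint c z) (codePoint c x) ≤ dist (codePoint c y) (codePoint c x) := by
  have hfar := (abs_le.1 (abs_dist_codePoint_div_scale_sub_le hy)).1
  have hnear := (abs_le.1 (abs_dist_codePoint_div_scale_sub_le hz)).2
  have := Digit.norm_point_sub_add_le_of_faces hface hcol hheight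
  rw [← div_le_div_iff_of_pos_right (scale_pos c n)]
  linarith

lemma faces_of_mem_flatCone {C : ℝ} (hC : C ≤ c n) (hy : y ∈ shell x n)
    (hcone : codePoint c y ∈ flatCone C (codePoint c x)) : (x n).Faces (y n) := by
  refine Digit.faces_of_abs_le hy.2 (norm_inv_scale_smul_codePoint_sub_sub_le hy.1) ?_
  simp only [PiLp.smul_apply, PiLp.sub_apply, smul_eq_mul, abs_mul]
  rw [mul_left_comm]
  gcongr
  exact hcone.2.trans (by gcongr)

/-- The law of a sequence of independent digits. -/
noncomputable def codeMeasure (c : ℕ → ℕ) : Measure (Code c) :=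
  Measure.infinitePi fun n => digitMeasure (c n)

instance (c : ℕ → ℕ) : IsProbabilityMeasure (codeMeasure c) := by
  unfold codeMeasure; infer_instance

/-- Let `y` have the highest `n`-th digit among the codes in question. The digit `m` in the column
of `x n`, one above the sum of the heights of `x n` and `y n`, is nearer to `x n` than `y n` is,
and outweighs all digits of the opposite column that are at most as high as `y n`. -/
lemma codeMeasure_flatCone_inter_shell_le {C : ℝ} (hC : C ≤ c n) (x : Code c) (r : ℝ) :
    codeMeasure c (codePoint c ⁻¹' (Metric.closedBall (codePoint c x) r ∩
      flatCone C (codePoint c x)) ∩ shell x n) ≤ (c n + 1 : ℝ≥0∞)⁻¹ *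
        codeMeasure c (codePoint c ⁻¹' Metric.closedBall (codePoint c x) r ∩
          PiNat.cylinder x n) := by
  set B := codePoint c ⁻¹' Metric.closedBall (codePoint c x) r
  set A := codePoint c ⁻¹' (Metric.closedBall (codePoint c x) r ∩ flatCone C (codePoint c x))
  have hfaces : ∀ y ∈ A ∩ shell x n, (x n).Faces (y n) := fun y hy =>
    faces_of_mem_flatCone hC hy.2 hy.1.2
  rcases (A ∩ shell x n).eq_empty_or_nonempty with hempty | hne
  · simp [hempty]
  obtain ⟨_, ⟨y, hy, rfl⟩, hmax⟩ := Set.exists_max_image ((fun y => y n) '' (A ∩ shell x n))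
    Digit.height (Set.toFinite _) (hne.image _)
  have hface := hfaces y hy
  set m : Digit (c n) :=
    (⟨(x n).height + (y n).height + 1, by have := hface.2; omega⟩, (x n).2)
  have hm : m.height = (x n).height + (y n).height + 1 := rfl
  calc codeMeasure c (A ∩ shell x n)
      ≤ codeMeasure c (PiNat.cylinder x n ∩
          {z | z n ∈ {d : Digit (c n) | d.2 = !(x n).2 ∧ d.height ≤ (y n).height}}) :=
        measure_mono fun z hz => ⟨hz.2.1, Bool.eq_not_of_ne (hfaces z hz).1,
          hmax _ (Set.mem_image_of_mem _ hz)⟩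
    _ = codeMeasure c (PiNat.cylinder x n) *
          digitMeasure (c n) {d | d.2 = !(x n).2 ∧ d.height ≤ (y n).height} :=
        infinitePi_cylinder_inter x n (Set.toFinite _).measurableSet
    _ ≤ codeMeasure c (PiNat.cylinder x n) * ((c n + 1 : ℝ≥0∞)⁻¹ * digitMeasure (c n) {m}) := by
        gcongr
        exact digitMeasure_column_le _ (by omega)
    _ = (c n + 1 : ℝ≥0∞)⁻¹ * codeMeasure c (PiNat.cylinder x n ∩ {z | z n ∈ ({m} : Set _)}) := by
        rw [mul_left_comm, codeMeasure, infinitePi_cylinder_inter x n (measurableSet_singleton m)]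
    _ ≤ (c n + 1 : ℝ≥0∞)⁻¹ * codeMeasure c (B ∩ PiNat.cylinder x n) := by
        gcongr _ * codeMeasure c ?_
        rintro z ⟨hz, hzm : z n = m⟩
        refine ⟨(dist_codePoint_le_of_faces hy.2.1 hface hz (by rw [hzm]) ?_).trans hy.1.1, hz⟩
        rw [hzm, hm, abs_le]
        push_cast
        constructor <;> linarith

lemma codeMeasure_flatCone_le {K N : ℕ} (hK : ∀ n ≥ N, K ≤ c n) (x : Code c) {r : ℝ}
    (hr : r < scale c N / 2) :
    codeMeasure c (codePoint c ⁻¹' (Metric.closedBall (codePoint c x) r ∩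
      flatCone K (codePoint c x))) ≤ 4 * (K + 1 : ℝ≥0∞)⁻¹ *
        codeMeasure c (codePoint c ⁻¹' Metric.closedBall (codePoint c x) r) := by
  set A := codePoint c ⁻¹' (Metric.closedBall (codePoint c x) r ∩ flatCone K (codePoint c x))
  have hKc : ∀ n, (A ∩ shell x n).Nonempty → K ≤ c n := fun n ⟨y, hyA, hy⟩ => hK n <| by
    by_contra! hn
    linarith [scale_div_two_le_dist_codePoint hy, scale_antitone c hn.le,
      Metric.mem_closedBall.1 hyA.1]
  refine measure_le_of_measure_inter_shell_le (x := x) (fun n => ?_) (fun h => h.2.1 rfl)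
    (fun n hne => ?_) fun n => ?_
  · rw [codeMeasure, infinitePi_cylinder_succ]
    gcongr
    exact digitMeasure_singleton_le _
  · obtain ⟨y, hyA, hy⟩ := hne
    have hface := faces_of_mem_flatCone (by exact_mod_cast hKc n ⟨y, hyA, hy⟩) hy hyA.2
    intro z hz
    obtain ⟨hz, hzx⟩ := mem_cylinder_succ_iff.1 hz
    refine (dist_codePoint_le_of_faces hy.1 hface hz (by rw [hzx]) ?_).trans hyA.1
    rw [hzx, sub_self, abs_zero]
    positivity
  · rcases (A ∩ shell x n).eq_empty_or_nonempty with hempty | hne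
    · simp [hempty]
    have hKn := hKc n hne
    refine (codeMeasure_flatCone_inter_shell_le (by exact_mod_cast hKn) x r).trans ?_
    gcongr

end Code

section Rectifiability

/-- The set lies over the `i`-th coordinate axis with slope at most `2`, so that its coordinates
are Lipschitz functions of the `i`-th one. -/
def IsLipschitzOverAxis (E : Set Plane) (i : Fin 2) : Prop :=
  ∀ u ∈ E, ∀ v ∈ E, ∀ j, |u j - v j| ≤ 2 * |u i - v i|

lemma eventually_norm_sub_le_of_hasStrictDerivAt {𝕜 E F : Type*} [NontriviallyNormedField 𝕜]
    [NormedAddCommGroup E] [NormedSpace 𝕜 E] [NormedAddCommGroup F] [NormedSpace 𝕜 F]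
    {f : 𝕜 → E} {g : 𝕜 → F} {f' : E} {g' : F} {t : 𝕜} {C : ℝ}
    (hf : HasStrictDerivAt f f' t) (hg : HasStrictDerivAt g g' t) (h : ‖g'‖ < C * ‖f'‖) :
    ∀ᶠ p : 𝕜 × 𝕜 in 𝓝 (t, t), ‖g p.1 - g p.2‖ ≤ C * ‖f p.1 - f p.2‖ := by
  have hC : 0 < C := pos_of_mul_pos_left ((norm_nonneg g').trans_lt h) (norm_nonneg f')
  set ε := (C * ‖f'‖ - ‖g'‖) / (C + 1)
  have hε : (C + 1) * ε = C * ‖f'‖ - ‖g'‖ := mul_div_cancel₀ _ (by positivity)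
  have hεpos : 0 < ε := div_pos (sub_pos.2 h) (by positivity)
  filter_upwards [hf.isLittleO.def hεpos, hg.isLittleO.def hεpos] with p hfp hgp
  rw [ContinuousLinearMap.toSpanSingleton_apply, norm_sub_rev] at hfp
  rw [ContinuousLinearMap.toSpanSingleton_apply] at hgp
  have hlower := (norm_sub_norm_le _ _).trans hfp
  have hupper := (norm_sub_norm_le _ _).trans hgp
  rw [norm_smul] at hlower hupper
  calc ‖g p.1 - g p.2‖ ≤ ‖p.1 - p.2‖ * ‖g'‖ + ε * ‖p.1 - p.2‖ := by linarith
    _ = C * (‖p.1 - p.2‖ * ‖f'‖ - ε * ‖p.1 - p.2‖) := by linear_combination ‖p.1 - p.2‖ * hε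
    _ ≤ C * ‖f p.1 - f p.2‖ := by gcongr; linarith

lemma exists_isLipschitzOverAxis_image {γ : ℝ → Plane} (hγ : IsC1Curve γ) (t : ℝ) :
    ∃ K ∈ 𝓝 t, IsCompact K ∧ ∃ i, IsLipschitzOverAxis (γ '' K) i := by
  obtain ⟨i, hi⟩ := Finite.exists_max fun i => |deriv γ t i|
  have hpos : 0 < |deriv γ t i| := by
    refine abs_pos.2 fun h => hγ.deriv_ne_zero t (PiLp.ext fun j => ?_)
    simpa [h] using hi j
  have hderiv : ∀ j, HasStrictDerivAt (fun s => γ s j) (deriv γ t j) t := fun j =>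
    (EuclideanSpace.proj (𝕜 := ℝ) j).hasStrictFDerivAt.comp_hasStrictDerivAt t
      (hγ.contDiff.contDiffAt.hasStrictDerivAt one_ne_zero)
  have hcoord : ∀ᶠ p : ℝ × ℝ in 𝓝 (t, t), ∀ j, |γ p.1 j - γ p.2 j| ≤ 2 * |γ p.1 i - γ p.2 i| :=
    eventually_all.2 fun j => eventually_norm_sub_le_of_hasStrictDerivAt (hderiv i) (hderiv j)
      (by simp only [Real.norm_eq_abs]; linarith [hi j])
  rw [nhds_prod_eq] at hcoord
  obtain ⟨U, hU, hU'⟩ := Filter.mem_prod_self_iff.1 hcoord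
  obtain ⟨K, hK, hKU, hKc⟩ := local_compact_nhds hU
  refine ⟨K, hK, hKc, i, ?_⟩
  rintro _ ⟨a, ha, rfl⟩ _ ⟨b, hb, rfl⟩
  exact hU' (Set.mk_mem_prod (hKU ha) (hKU hb))

lemma purelyOneUnrectifiable_of_isLipschitzOverAxis {μ : Measure Plane}
    (h : ∀ E i, IsCompact E → IsLipschitzOverAxis E i → μ E = 0) : PurelyOneUnrectifiable μ := by
  rintro A ⟨γ, hγ, hA⟩
  refine measure_mono_null hA (measure_iUnion_null fun k => ?_)
  choose K hK hKc i hi using exists_isLipschitzOverAxis_image (hγ k)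
  obtain ⟨s, hs, hs'⟩ := TopologicalSpace.countable_cover_nhds hK
  rw [← Set.image_univ, ← hs', Set.image_iUnion₂]
  exact (measure_biUnion_null_iff hs).2 fun t _ =>
    h _ (i t) ((hKc t).image (hγ k).contDiff.continuous) (hi t)

lemma Digit.exists_one_le_abs_point_sub_of_ne {k : ℕ} {i j : Fin 2} (hij : i ≠ j) :
    ∃ d d' : Digit k, 1 ≤ |d'.point j - d.point j| ∧ d'.point i = d.point i := by
  match i, j with
  | 0, 0 | 1, 1 => exact absurd rfl hij
  | 0, 1 => exact ⟨(0, true), (1, true), by simp [point_one, height], by simp [point_zero]⟩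
  | 1, 0 =>
    refine ⟨(0, true), (0, false), ?_, by simp [point_one, height]⟩
    rw [abs_point_sub_point_zero, if_neg (by simp)]
    linarith [k.cast_nonneg (α := ℝ)]

lemma codeMeasure_preimage_eq_zero {c : ℕ → ℕ} (hc : ¬Summable fun n => minMass (c n))
    {E : Set Plane} {i : Fin 2} (hE : IsLipschitzOverAxis E i) :
    codeMeasure c (codePoint c ⁻¹' E) = 0 := by
  refine infinitePi_eq_zero_of_forall_exists_missing (fun n => (minMass_pos (c n)).le) hc
    (fun n => minMass_le) fun x n => ?_
  by_contra! hcon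
  obtain ⟨j, hji⟩ := exists_ne i
  obtain ⟨d, d', hj, hi⟩ := Digit.exists_one_le_abs_point_sub_of_ne (k := c n) hji.symm
  obtain ⟨y, ⟨hyE, hy⟩, rfl⟩ := hcon d
  obtain ⟨z, ⟨hzE, hz⟩, rfl⟩ := hcon d'
  have hzy : z ∈ PiNat.cylinder y n := by rwa [PiNat.mem_cylinder_iff_eq.1 hy]
  set p := (scale c n)⁻¹ • (codePoint c z - codePoint c y)
  have hp : ∀ l, |p l - ((z n).point l - (y n).point l)| ≤ 1 / 4 := fun l =>
    (PiLp.norm_apply_le (p - ((z n).point - (y n).point)) l).trans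
      ((norm_inv_scale_smul_codePoint_sub_sub_le hzy).trans (Digit.tolerance_le _))
  have hpj : |p j| ≤ 2 * |p i| := by
    simp only [p, PiLp.smul_apply, PiLp.sub_apply, smul_eq_mul, abs_mul]
    rw [mul_left_comm]
    gcongr
    exact hE _ hzE _ hyE j
  have hpi := hp i
  rw [hi, sub_self, sub_zero] at hpi
  have := abs_sub_abs_le_abs_sub ((z n).point j - (y n).point j) (p j)
  have := (abs_sub_comm _ _).trans_le (hp j)
  linarith

end Rectifiability

section PointMeasure

variable {c : ℕ → ℕ}

/-- The law of the point whose digits are independent. -/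
noncomputable def pointMeasure (c : ℕ → ℕ) : Measure Plane := (codeMeasure c).map (codePoint c)

lemma measurable_codePoint (c : ℕ → ℕ) : Measurable (codePoint c) :=
  (continuous_codePoint c).measurable

instance (c : ℕ → ℕ) : IsProbabilityMeasure (pointMeasure c) :=
  Measure.isProbabilityMeasure_map (measurable_codePoint c).aemeasurable

lemma purelyOneUnrectifiable_pointMeasure (hc : ¬Summable fun n => minMass (c n)) :
    PurelyOneUnrectifiable (pointMeasure c) :=
  purelyOneUnrectifiable_of_isLipschitzOverAxis fun E i hcomp hE => by
    rw [pointMeasure, Measure.map_apply (measurable_codePoint c) hcomp.measurableSet]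
    exact codeMeasure_preimage_eq_zero hc hE

lemma ae_pointMeasure_of_forall {p : Plane → Prop} (h : ∀ x, p (codePoint c x)) :
    ∀ᵐ u ∂pointMeasure c, p u := by
  have hrange : MeasurableSet (Set.range (codePoint c)) :=
    (isCompact_range (continuous_codePoint c)).measurableSet
  filter_upwards [ae_map_mem_range (codePoint c) hrange (codeMeasure c)] with u hu
  obtain ⟨x, rfl⟩ := hu
  exact h x

lemma tendsto_pointMeasure_truncCone (hc : Tendsto c atTop atTop) {α : ℝ} (hα : α < 1)
    (x : Code c) :
    Tendsto (fun r : ℝ => pointMeasure c (truncCone (codePoint c x) r horizontalAxis α) /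
      pointMeasure c (Metric.closedBall (codePoint c x) r)) (𝓝[>] 0) (𝓝 0) := by
  have hδ : Tendsto (fun K : ℕ => 4 * (K + 1 : ℝ≥0∞)⁻¹) atTop (𝓝 0) := by
    simpa using ENNReal.Tendsto.const_mul (a := 4)
      ((tendsto_add_atTop_iff_nat 1).2 ENNReal.tendsto_inv_nat_nhds_zero) (by simp)
  refine ENNReal.tendsto_nhds_zero.2 fun ε hε => ?_
  obtain ⟨K, hKε, hKα⟩ := ((ENNReal.tendsto_nhds_zero.1 hδ ε hε).and
    (tendsto_natCast_atTop_atTop.eventually_ge_atTop (1 / (1 - α)))).exists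
  obtain ⟨N, hN⟩ := eventually_atTop.1 (hc.eventually_ge_atTop K)
  filter_upwards [Ioo_mem_nhdsGT (half_pos (scale_pos c N))] with r hr
  rw [pointMeasure, Measure.map_apply (measurable_codePoint c) (measurableSet_truncCone _ _ _ _),
    Measure.map_apply (measurable_codePoint c) Metric.isClosed_closedBall.measurableSet]
  refine ENNReal.div_le_of_le_mul ?_
  refine (measure_mono (Set.preimage_mono (Set.inter_subset_inter_right _ ?_))).trans
    ((codeMeasure_flatCone_le hN x hr.2).trans (by gcongr))
  exact cone_horizontalAxis_subset_flatCone _ hα hKα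

end PointMeasure

lemma exists_tendsto_atTop_not_summable_comp {δ : ℕ → ℝ} (hδ : ∀ k, 0 < δ k) :
    ∃ c : ℕ → ℕ, Tendsto c atTop atTop ∧ ¬Summable fun n => δ (c n) := by
  classical
  have hinv : ∀ k, ∃ m : ℕ, ∀ n ≥ m, (n : ℝ)⁻¹ ≤ δ k := fun k =>
    eventually_atTop.1 (tendsto_inv_atTop_nhds_zero_nat.eventually_le_const (hδ k))
  choose m hm using hinv
  set c : ℕ → ℕ := fun n => Nat.findGreatest (fun k => ((n + m 0 : ℕ) : ℝ)⁻¹ ≤ δ k) n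
  have hc : ∀ n, ((n + m 0 : ℕ) : ℝ)⁻¹ ≤ δ (c n) := fun n =>
    Nat.findGreatest_spec (P := fun k => ((n + m 0 : ℕ) : ℝ)⁻¹ ≤ δ k) n.zero_le
      (hm 0 _ (Nat.le_add_left _ _))
  refine ⟨c, tendsto_atTop.2 fun K => ?_, fun hsum => Real.not_summable_natCast_inv ?_⟩
  · filter_upwards [eventually_ge_atTop K, eventually_ge_atTop (m K)] with n hK hmK
    exact Nat.le_findGreatest hK (hm K _ (Nat.le_add_right_of_le hmK))
  · exact (summable_nat_add_iff (m 0)).1 (hsum.of_nonneg_of_le (fun n => by positivity) hc)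

theorem mainTheorem4 :
    ∃ (ℓ : Submodule ℝ Plane) (μ : Measure Plane),
      IsLine ℓ ∧ IsFiniteMeasure μ ∧ μ ≠ 0 ∧ PurelyOneUnrectifiable μ ∧
      ∀ α : ℝ, 0 < α → α < 1 →
        ∀ᵐ x ∂μ, Tendsto (fun r : ℝ => μ (truncCone x r ℓ α) / μ (Metric.closedBall x r))
          (𝓝[>] 0) (𝓝 0) := by
  obtain ⟨c, hc, hsum⟩ := exists_tendsto_atTop_not_summable_comp minMass_pos
  exact ⟨horizontalAxis, pointMeasure c, isLine_horizontalAxis, inferInstance,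
    IsProbabilityMeasure.ne_zero _, purelyOneUnrectifiable_pointMeasure hsum,
    fun α _ hα => ae_pointMeasure_of_forall (tendsto_pointMeasure_truncCone hc hα)⟩
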